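/- Conventions. An MV-algebra is a structure $(A,\oplus,0,1,\neg)$ such that $(A,\oplus,0)$ is a commutative monoid, $\neg 0=1$, $x\oplus 1=1$, $\neg\neg x=x$ and $\neg(\neg x\oplus y)\oplus y=\neg(\neg y\oplus x)\oplus x$. It is a lattice for the order in which $x\le y$ if and only if $y=x\oplus z$ for some $z$. Put $x\odot y=\neg(\neg x\oplus\neg y)$, $x^2=x\odot x$, $2x=x\oplus x$ and, in general, $nx=x\oplus\dots\oplus x$ ($n$ times). The radical $\mathrm{Rad}(A)$ is the set of all $x\in A$ with $nx\le\neg x$ for every positive integer $n$. A perfect MV-algebra is an MV-algebra with $0\neq1$ that is generated, as an MV-algebra, by its radical. Let $\mathrm{PERF}$ be the category of perfect MV-algebras and MV-algebra homomorphisms, and let $\ell\mathcal G$ be the category of abelian lattice-ordered groups ($\ell$-groups) and $\ell$-group homomorphisms. Let $\Delta:\ell\mathcal G\to\mathrm{PERF}$ be the functor sending $G$ to the interval $[(0,0),(1,0)]$ of the lexicographic product $\mathbb Z\times_{\mathrm{lex}}G$, with $x\oplus y=(x+y)\wedge(1,0)$ and $\neg x=(1,0)-x$, and sending $f:G\to H$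 to the map $(n,g)\mapsto(n,f(g))$. Let $\mathrm{TOP}$ be the following category. Its objects are the structures $(S,+,0,\wedge,\vee,\top)$ isomorphic to $G^+\cup\{\top\}$ for some abelian $\ell$-group $G$, where $G^+=\{g\in G: g\ge 0\}$ is the positive cone and $\top$ is a new element with $x\le\top$ and $x+\top=\top$ for all $x$. Its morphisms are the maps preserving $+,0,\wedge,\vee$ and $\top$ that send the positive cone $S\setminus\{\top\}$ of the source into the positive cone of the target. For an MV-algebra $A$ let $\theta(A)=\{x\in A: x\ge 2x^2\}$. For a perfect MV-algebra $P$ regard $\theta(P)$ as a structure with the operations $\oplus,0,\wedge,\vee$ of $P$ and top $1$; for a homomorphism $h:P\to Q$ of perfect MV-algebras let $\theta(h):\theta(P)\to\theta(Q)$ be the restriction of $h$. Theorem. For every perfect MV-algebra $P$ one has $\theta(P)=\mathrm{Rad}(P)\cup\{1\}$, and $\theta(P)$ is an object of $\mathrm{TOP}$. The functor $\theta:\mathrm{PERF}\to\mathrm{TOP}$ is an equivalence of categories, and $\theta\circ\Delta:\ell\mathcal G\to\mathrm{TOP}$ is an equivalence of categories. -/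

import Mathlib

open CategoryTheory

universe u

/-! ### MV-algebras -/

/-- An MV-algebra. The operation `⊕` is written `+` (so that the multiple `nx` is `n • x`), and the
negation `¬ x` is written `xᶜ`. -/
class MVAlgebra (A : Type u) extends AddCommMonoid A, One A, Compl A where
  mv_compl_zero : (0 : A)ᶜ = 1
  mv_add_one : ∀ x : A, x + 1 = 1
  mv_compl_compl : ∀ x : A, xᶜᶜ = x
  mv_lukasiewicz : ∀ x y : A, (xᶜ + y)ᶜ + y = (yᶜ + x)ᶜ + x

namespace MVAlgebra

section Basic

variable {A : Type u} [MVAlgebra A]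

/-- `x ⊙ y = ¬(¬ x ⊕ ¬ y)`. -/
def odot (x y : A) : A := (xᶜ + yᶜ)ᶜ

theorem mv_compl_one : (1 : A)ᶜ = 0 := by
  rw [← mv_compl_zero, mv_compl_compl]

theorem mv_compl_add_self (x : A) : xᶜ + x = 1 := by
  have h := mv_lukasiewicz x 1
  rw [mv_add_one, mv_compl_one, zero_add] at h
  exact h.symm

theorem mv_exists_iff (x y : A) : (∃ z, y = x + z) ↔ xᶜ + y = 1 := by
  constructor
  · rintro ⟨z, rfl⟩
    rw [← add_assoc, mv_compl_add_self, add_comm, mv_add_one]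
  · intro h
    refine ⟨(yᶜ + x)ᶜ, ?_⟩
    have h2 := mv_lukasiewicz x y
    rw [h, mv_compl_one, zero_add] at h2
    rw [add_comm]
    exact h2

/-- The natural order: `x ≤ y` if and only if `y = x ⊕ z` for some `z`. -/
instance (priority := 50) instPartialOrder : PartialOrder A where
  le x y := ∃ z, y = x + z
  le_refl x := ⟨0, (add_zero x).symm⟩
  le_trans x y z := by
    rintro ⟨a, rfl⟩ ⟨b, rfl⟩
    exact ⟨a + b, add_assoc _ _ _⟩
  le_antisymm x y h1 h2 := by
    have h1' := (mv_exists_iff x y).1 h1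
    have h2' := (mv_exists_iff y x).1 h2
    have h := mv_lukasiewicz x y
    rw [h1', h2', mv_compl_one, zero_add, zero_add] at h
    exact h.symm

theorem mv_le_def {x y : A} : x ≤ y ↔ ∃ z, y = x + z := Iff.rfl

theorem mv_le_iff {x y : A} : x ≤ y ↔ xᶜ + y = 1 := mv_exists_iff x y

theorem mv_le_add_right (x y : A) : x ≤ x + y := ⟨y, rfl⟩

theorem mv_le_add_left (x y : A) : x ≤ y + x := ⟨y, add_comm _ _⟩

theorem mv_add_le_add {x y z w : A} (h : x ≤ y) (h2 : z ≤ w) : x + z ≤ y + w := by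
  obtain ⟨a, rfl⟩ := h
  obtain ⟨b, rfl⟩ := h2
  exact ⟨a + b, add_add_add_comm _ _ _ _⟩

theorem mv_compl_le_compl {x y : A} (h : x ≤ y) : yᶜ ≤ xᶜ := by
  rw [mv_le_iff] at *
  rw [mv_compl_compl, add_comm, h]

theorem mv_le_compl_comm {x y : A} (h : x ≤ yᶜ) : y ≤ xᶜ := by
  have := mv_compl_le_compl h
  rwa [mv_compl_compl] at this

theorem mv_zero_le (x : A) : 0 ≤ x := ⟨x, (zero_add x).symm⟩

theorem mv_le_one (x : A) : x ≤ 1 := by rw [mv_le_iff, mv_add_one]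

theorem mv_join_eq {x y : A} (h : x ≤ y) : (yᶜ + x)ᶜ + x = y := by
  have h2 := mv_lukasiewicz x y
  rw [mv_le_iff.1 h, mv_compl_one, zero_add] at h2
  exact h2.symm

theorem mv_join_le {x y z : A} (hx : x ≤ z) (hy : y ≤ z) : (xᶜ + y)ᶜ + y ≤ z := by
  have h1 : (xᶜ + y)ᶜ ≤ (zᶜ + y)ᶜ :=
    mv_compl_le_compl (mv_add_le_add (mv_compl_le_compl hx) le_rfl)
  have h2 := mv_add_le_add h1 (le_refl y)
  rwa [mv_join_eq hy] at h2

/-- The lattice operations: `x ∨ y = ¬(¬ x ⊕ y) ⊕ y` and `x ∧ y = ¬(¬ x ∨ ¬ y)`. They are the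
suprema and infima for the natural order. -/
instance (priority := 50) instLattice : Lattice A where
  sup x y := (xᶜ + y)ᶜ + y
  le_sup_left x y := by
    rw [mv_lukasiewicz]
    exact mv_le_add_left _ _
  le_sup_right x y := mv_le_add_left _ _
  sup_le x y z := mv_join_le
  inf x y := ((xᶜᶜ + yᶜ)ᶜ + yᶜ)ᶜ
  inf_le_left x y := by
    have h : xᶜ ≤ (xᶜᶜ + yᶜ)ᶜ + yᶜ := by
      rw [mv_lukasiewicz]
      exact mv_le_add_left _ _
    exact (mv_compl_le_compl h).trans (le_of_eq (mv_compl_compl x))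
  inf_le_right x y := by
    have h2 := mv_compl_le_compl (mv_le_add_left yᶜ (xᶜᶜ + yᶜ)ᶜ)
    rwa [mv_compl_compl y] at h2
  le_inf x y z hy hz :=
    mv_le_compl_comm (mv_join_le (mv_compl_le_compl hy) (mv_compl_le_compl hz))

theorem mv_sup_def (x y : A) : x ⊔ y = (xᶜ + y)ᶜ + y := rfl

theorem mv_inf_def (x y : A) : x ⊓ y = (xᶜ ⊔ yᶜ)ᶜ := rfl

theorem mv_sup_le_add (x y : A) : x ⊔ y ≤ x + y :=
  sup_le (mv_le_add_right _ _) (mv_le_add_left _ _)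

theorem mv_odot_comm (x y : A) : odot x y = odot y x := by
  rw [odot, odot, add_comm]

theorem mv_odot_assoc (x y z : A) : odot (odot x y) z = odot x (odot y z) := by
  simp only [odot, mv_compl_compl, add_assoc]

theorem mv_odot_le_iff {x y z : A} : odot x y ≤ z ↔ x ≤ yᶜ + z := by
  rw [mv_le_iff, mv_le_iff, odot, mv_compl_compl, add_assoc]

theorem mv_odot_mono {x y z w : A} (h : x ≤ y) (h2 : z ≤ w) : odot x z ≤ odot y w :=
  mv_compl_le_compl (mv_add_le_add (mv_compl_le_compl h) (mv_compl_le_compl h2))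

theorem mv_odot_le_right (x y : A) : odot x y ≤ y := by
  rw [mv_odot_le_iff, mv_compl_add_self]
  exact mv_le_one x

theorem mv_odot_le_left (x y : A) : odot x y ≤ x := by
  rw [mv_odot_comm]
  exact mv_odot_le_right y x

theorem mv_le_zero_iff {x : A} : x ≤ 0 ↔ x = 0 :=
  ⟨fun h => le_antisymm h (mv_zero_le x), fun h => h ▸ le_rfl⟩

theorem mv_odot_eq_zero_iff {x y : A} : odot x y = 0 ↔ x ≤ yᶜ := by
  rw [← mv_le_zero_iff, mv_odot_le_iff, add_zero]

theorem mv_odot_compl_add (x y : A) : odot x (xᶜ + y) = x ⊓ y := by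
  rw [inf_comm, mv_inf_def, mv_sup_def, mv_compl_compl, odot, add_comm xᶜ (xᶜ + y)ᶜ, add_comm y]

theorem mv_minus_inf_minus (x y : A) : odot x yᶜ ⊓ odot y xᶜ = 0 := by
  have hd : (odot x yᶜ)ᶜ = xᶜ + y := by simp only [odot, mv_compl_compl]
  generalize he : odot y xᶜ = e
  have h1 : odot x yᶜ ⊓ e = odot (odot e (eᶜ + x)) ((xᶜ + e)ᶜ + yᶜ) := by
    rw [← mv_odot_compl_add, hd, mv_odot_compl_add e x, inf_comm e x, ← mv_odot_compl_add x e,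
      mv_odot_assoc, mv_odot_assoc, mv_odot_compl_add (xᶜ + e) yᶜ, inf_comm (xᶜ + e),
      ← mv_odot_compl_add yᶜ, mv_compl_compl, add_comm xᶜ y, add_assoc]
  rw [h1, ← mv_le_zero_iff]
  have h2 : odot (odot e (eᶜ + x)) ((xᶜ + e)ᶜ + yᶜ) ≤ odot e ((xᶜ + e)ᶜ + yᶜ) :=
    mv_odot_mono (mv_odot_le_left _ _) le_rfl
  refine h2.trans ?_
  have h3 : odot e ((xᶜ + e)ᶜ + yᶜ) = odot xᶜ (y ⊓ (xᶜ + e)ᶜ) := by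
    rw [← mv_odot_compl_add, ← mv_odot_assoc, mv_odot_comm xᶜ y, he, add_comm yᶜ]
  have h4 : (xᶜ + e)ᶜ ≤ x := by
    have := mv_compl_le_compl (mv_le_add_right xᶜ e)
    rwa [mv_compl_compl] at this
  rw [h3]
  have h5 : odot xᶜ (y ⊓ (xᶜ + e)ᶜ) ≤ odot xᶜ x := mv_odot_mono le_rfl (inf_le_right.trans h4)
  refine h5.trans ?_
  rw [mv_le_zero_iff, mv_odot_eq_zero_iff]

theorem mv_prelinear (x y : A) : (xᶜ + y) ⊔ (yᶜ + x) = 1 := by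
  have h := mv_minus_inf_minus x y
  have h2 := congrArg (fun z : A => zᶜ) h
  simpa only [mv_inf_def, mv_compl_compl, odot, mv_compl_zero] using h2

theorem mv_le_compl_of_square {a b : A} (ha : a ≤ aᶜ) (hb : b ≤ bᶜ) : a ≤ bᶜ := by
  have h1 : aᶜ + b ≤ (odot a b)ᶜ := by
    apply mv_le_compl_comm
    rw [← mv_odot_eq_zero_iff, mv_odot_comm a b, mv_odot_assoc, mv_odot_compl_add,
      ← mv_le_zero_iff]
    refine (mv_odot_mono le_rfl inf_le_right).trans ?_
    rw [mv_le_zero_iff, mv_odot_eq_zero_iff]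
    exact hb
  have h2 : bᶜ + a ≤ (odot a b)ᶜ := by
    apply mv_le_compl_comm
    rw [← mv_odot_eq_zero_iff, mv_odot_assoc, mv_odot_compl_add, ← mv_le_zero_iff]
    refine (mv_odot_mono le_rfl inf_le_right).trans ?_
    rw [mv_le_zero_iff, mv_odot_eq_zero_iff]
    exact ha
  have h3 := sup_le h1 h2
  rw [mv_prelinear] at h3
  have h4 := mv_le_compl_comm h3
  rw [mv_compl_one, mv_le_zero_iff, mv_odot_eq_zero_iff] at h4
  exact h4

theorem mv_partial_assoc {a b c : A} (h1 : a ≤ bᶜ) (h2 : a + b ≤ cᶜ) : a ≤ (b + c)ᶜ := by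
  have h3 : a = odot bᶜ (b + a) := by
    have := mv_odot_compl_add bᶜ a
    rw [mv_compl_compl, inf_eq_right.2 h1] at this
    exact this.symm
  have h4 : odot bᶜ (b + a) ≤ odot bᶜ cᶜ := mv_odot_mono le_rfl (by rwa [add_comm])
  rw [← h3, odot, mv_compl_compl, mv_compl_compl] at h4
  exact h4

theorem mv_partial_assoc_rev {a b c : A} (h1 : b ≤ cᶜ) (h2 : a ≤ (b + c)ᶜ) : a + b ≤ cᶜ := by
  have h3 := mv_add_le_add h2 (le_refl b)
  have h4 := mv_join_eq h1
  rw [mv_compl_compl, add_comm c b] at h4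
  rwa [h4] at h3

end Basic

/-! ### The radical, perfect MV-algebras, and `θ` -/

/-- `x` is infinitesimal if `n x ≤ ¬ x` for every positive integer `n`; the radical is the set of
all infinitesimals. -/
def rad (A : Type u) [MVAlgebra A] : Set A := {x | ∀ n : ℕ, 0 < n → n • x ≤ xᶜ}

/-- Subalgebras of an MV-algebra. -/
structure IsSubalgebra {A : Type u} [MVAlgebra A] (S : Set A) : Prop where
  zero_mem : 0 ∈ S
  add_mem : ∀ x ∈ S, ∀ y ∈ S, x + y ∈ S
  compl_mem : ∀ x ∈ S, xᶜ ∈ S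

/-- The subalgebra generated by a set. -/
def generatedBy {A : Type u} [MVAlgebra A] (X : Set A) : Set A :=
  ⋂₀ {S : Set A | IsSubalgebra S ∧ X ⊆ S}

/-- A perfect MV-algebra is a nontrivial MV-algebra generated by its radical. -/
structure IsPerfect (A : Type u) [MVAlgebra A] : Prop where
  zero_ne_one : (0 : A) ≠ 1
  generated : generatedBy (rad A) = Set.univ

/-- `θ(A) = {x | x ≥ 2 x²}`, where `x² = x ⊙ x` and `2 x = x ⊕ x`. -/
def theta (A : Type u) [MVAlgebra A] : Set A := {x | x ≥ 2 • odot x x}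

section Radical

variable {A : Type u} [MVAlgebra A]

theorem zero_mem_rad : (0 : A) ∈ rad A := fun n _ => by
  rw [smul_zero]
  exact mv_zero_le _

theorem nsmul_mono {x y : A} (h : x ≤ y) (n : ℕ) : n • x ≤ n • y := by
  induction n with
  | zero => rw [zero_smul, zero_smul]
  | succ n ih =>
    rw [succ_nsmul, succ_nsmul]
    exact mv_add_le_add ih h

theorem rad_of_le {x y : A} (hx : x ∈ rad A) (h : y ≤ x) : y ∈ rad A := fun n hn =>
  ((nsmul_mono h n).trans (hx n hn)).trans (mv_compl_le_compl h)

theorem nsmul_le_compl_nsmul {x : A} (hx : x ∈ rad A) (m n : ℕ) : m • x ≤ (n • x)ᶜ := by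
  induction n generalizing m with
  | zero =>
    rw [zero_smul, mv_compl_zero]
    exact mv_le_one _
  | succ n ih =>
    have h1 : m • x ≤ xᶜ := by
      rcases Nat.eq_zero_or_pos m with rfl | hm
      · rw [zero_smul]
        exact mv_zero_le _
      · exact hx m hm
    have h2 := ih (m + 1)
    rw [succ_nsmul] at h2
    have h3 := mv_partial_assoc h1 h2
    rwa [succ_nsmul']

theorem add_mem_rad {x y : A} (hx : x ∈ rad A) (hy : y ∈ rad A) : x + y ∈ rad A := by
  have key : ∀ n : ℕ, n • (x + y) ≤ (n • (x + y))ᶜ := by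
    intro n
    rw [smul_add]
    have hp := nsmul_le_compl_nsmul hx n n
    have hq := nsmul_le_compl_nsmul hy n n
    have hu := nsmul_le_compl_nsmul hx (n + n) (n + n)
    have hv := nsmul_le_compl_nsmul hy (n + n) (n + n)
    have huv := mv_le_compl_of_square hu hv
    rw [add_smul, add_smul] at huv
    have h1 := mv_partial_assoc hp huv
    have h2 := mv_partial_assoc hq (mv_le_compl_comm huv)
    refine mv_partial_assoc_rev ?_ ?_
    · refine h2.trans (mv_compl_le_compl ?_)
      exact ⟨n • x, by abel⟩
    · refine h1.trans (le_of_eq ?_)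
      congr 1
      abel
  intro n _
  have h1 := key 1
  rw [one_smul] at h1
  exact mv_le_compl_of_square (key n) h1

theorem mv_square_eq_zero {x : A} (hx : x ∈ rad A) : odot x x = 0 := by
  rw [mv_odot_eq_zero_iff]
  simpa using nsmul_le_compl_nsmul hx 1 1

theorem rad_subset_theta {x : A} (hx : x ∈ rad A) : x ∈ theta A := by
  change 2 • odot x x ≤ x
  rw [mv_square_eq_zero hx, smul_zero]
  exact mv_zero_le x

theorem one_mem_theta : (1 : A) ∈ theta A := mv_le_one _

theorem IsPerfect.mem_or (h : IsPerfect A) (x : A) : x ∈ rad A ∨ xᶜ ∈ rad A := by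
  have hx : x ∈ generatedBy (rad A) := by
    rw [h.generated]
    trivial
  refine hx {x | x ∈ rad A ∨ xᶜ ∈ rad A} ⟨⟨Or.inl zero_mem_rad, ?_, ?_⟩, fun y hy => Or.inl hy⟩
  · rintro y (hy | hy) z (hz | hz)
    · exact Or.inl (add_mem_rad hy hz)
    · exact Or.inr (rad_of_le hz (mv_compl_le_compl (mv_le_add_left _ _)))
    · exact Or.inr (rad_of_le hy (mv_compl_le_compl (mv_le_add_right _ _)))
    · exact Or.inr (rad_of_le hy (mv_compl_le_compl (mv_le_add_right _ _)))
  · rintro y (hy | hy)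
    · exact Or.inr (by rwa [mv_compl_compl])
    · exact Or.inl hy

theorem IsPerfect.mem_theta_iff (h : IsPerfect A) (x : A) : x ∈ theta A ↔ x ∈ rad A ∨ x = 1 := by
  constructor
  · intro hx
    rcases h.mem_or x with hr | hr
    · exact Or.inl hr
    · right
      have h1 : (2 • xᶜ) ≤ (2 • xᶜ)ᶜ := nsmul_le_compl_nsmul hr 2 2
      have h2 : (2 • xᶜ)ᶜ + (2 • xᶜ)ᶜ = 1 := mv_le_iff.1 h1
      have h3 : odot x x = (2 • xᶜ)ᶜ := by rw [odot, two_nsmul]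
      have h4 : 2 • odot x x ≤ x := hx
      rw [h3, two_nsmul, h2] at h4
      exact le_antisymm (mv_le_one x) h4
  · rintro (hx | rfl)
    · exact rad_subset_theta hx
    · exact one_mem_theta

theorem IsPerfect.one_notMem_rad (h : IsPerfect A) : (1 : A) ∉ rad A := fun h1 => by
  have h2 := h1 1 one_pos
  rw [one_smul, mv_compl_one, mv_le_zero_iff] at h2
  exact h.zero_ne_one h2.symm

theorem IsPerfect.add_mem_theta (h : IsPerfect A) {x y : A} (hx : x ∈ theta A)
    (hy : y ∈ theta A) : x + y ∈ theta A := by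
  rw [h.mem_theta_iff] at *
  rcases hx with hx | rfl
  · rcases hy with hy | rfl
    · exact Or.inl (add_mem_rad hx hy)
    · exact Or.inr (mv_add_one x)
  · exact Or.inr (by rw [add_comm, mv_add_one])

theorem IsPerfect.inf_mem_theta (h : IsPerfect A) {x y : A} (hx : x ∈ theta A)
    (hy : y ∈ theta A) : x ⊓ y ∈ theta A := by
  rw [h.mem_theta_iff] at *
  rcases hx with hx | rfl
  · exact Or.inl (rad_of_le hx inf_le_left)
  · rwa [inf_eq_right.2 (mv_le_one y)]

theorem IsPerfect.sup_mem_theta (h : IsPerfect A) {x y : A} (hx : x ∈ theta A)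
    (hy : y ∈ theta A) : x ⊔ y ∈ theta A := by
  rw [h.mem_theta_iff] at *
  rcases hx with hx | rfl
  · rcases hy with hy | rfl
    · exact Or.inl (rad_of_le (add_mem_rad hx hy) (mv_sup_le_add x y))
    · exact Or.inr (sup_eq_right.2 (mv_le_one x))
  · exact Or.inr (sup_eq_left.2 (mv_le_one y))

end Radical

end MVAlgebra

open MVAlgebra

/-! ### The category of MV-algebras and the category `PERF` of perfect MV-algebras -/

/-- Homomorphisms of MV-algebras. -/
@[ext]
structure MVHom (A B : Type u) [MVAlgebra A] [MVAlgebra B] where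
  toFun : A → B
  map_zero : toFun 0 = 0
  map_one : toFun 1 = 1
  map_add : ∀ x y, toFun (x + y) = toFun x + toFun y
  map_compl : ∀ x, toFun xᶜ = (toFun x)ᶜ

namespace MVHom

variable {A B : Type u} [MVAlgebra A] [MVAlgebra B] (f : MVHom A B)

theorem map_le {x y : A} (h : x ≤ y) : f.toFun x ≤ f.toFun y := by
  obtain ⟨z, rfl⟩ := h
  exact ⟨f.toFun z, f.map_add x z⟩

theorem map_nsmul (n : ℕ) (x : A) : f.toFun (n • x) = n • f.toFun x := by
  induction n with
  | zero => rw [zero_smul, zero_smul, f.map_zero]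
  | succ n ih => rw [succ_nsmul, succ_nsmul, f.map_add, ih]

theorem map_sup (x y : A) : f.toFun (x ⊔ y) = f.toFun x ⊔ f.toFun y := by
  simp only [mv_sup_def, f.map_add, f.map_compl]

theorem map_inf (x y : A) : f.toFun (x ⊓ y) = f.toFun x ⊓ f.toFun y := by
  simp only [mv_inf_def, f.map_sup, f.map_compl]

theorem map_odot (x y : A) : f.toFun (odot x y) = odot (f.toFun x) (f.toFun y) := by
  simp only [odot, f.map_add, f.map_compl]

theorem map_rad {x : A} (hx : x ∈ rad A) : f.toFun x ∈ rad B := fun n hn => by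
  have := f.map_le (hx n hn)
  rwa [map_nsmul, map_compl] at this

theorem map_theta {x : A} (hx : x ∈ theta A) : f.toFun x ∈ theta B := by
  have := f.map_le hx
  rwa [map_nsmul, map_odot] at this

end MVHom

/-- MV-algebras, as objects of a category. -/
structure MVAlg where
  carrier : Type u
  [str : MVAlgebra carrier]

attribute [instance] MVAlg.str

instance : Category MVAlg.{u} where
  Hom A B := MVHom A.carrier B.carrier
  id _ := ⟨fun x => x, rfl, rfl, fun _ _ => rfl, fun _ => rfl⟩
  comp f g :=
    { toFun := fun x => g.toFun (f.toFun x)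
      map_zero := by rw [f.map_zero, g.map_zero]
      map_one := by rw [f.map_one, g.map_one]
      map_add := fun x y => by rw [f.map_add, g.map_add]
      map_compl := fun x => by rw [f.map_compl, g.map_compl] }

/-- The category of perfect MV-algebras, a full subcategory of the category of MV-algebras. -/
abbrev PERF : Type (u + 1) :=
  ObjectProperty.FullSubcategory (C := MVAlg.{u}) fun A => IsPerfect A.carrier

/-! ### The category of abelian `ℓ`-groups -/

/-- Abelian lattice-ordered groups, as objects of a category. -/
structure LGrp where
  carrier : Type u
  [addCommGroup : AddCommGroup carrier]
  [lattice : Lattice carrier]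
  [isOrdered : IsOrderedAddMonoid carrier]

attribute [instance] LGrp.addCommGroup LGrp.lattice LGrp.isOrdered

/-- Homomorphisms of `ℓ`-groups: group homomorphisms that are lattice homomorphisms. -/
@[ext]
structure LGrpHom (G H : Type u) [AddCommGroup G] [Lattice G] [AddCommGroup H] [Lattice H] where
  toFun : G → H
  map_add : ∀ x y, toFun (x + y) = toFun x + toFun y
  map_inf : ∀ x y, toFun (x ⊓ y) = toFun x ⊓ toFun y
  map_sup : ∀ x y, toFun (x ⊔ y) = toFun x ⊔ toFun y

instance : Category LGrp.{u} where
  Hom G H := LGrpHom G.carrier H.carrier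
  id _ := ⟨fun x => x, fun _ _ => rfl, fun _ _ => rfl, fun _ _ => rfl⟩
  comp f g :=
    { toFun := fun x => g.toFun (f.toFun x)
      map_add := fun x y => by rw [f.map_add, g.map_add]
      map_inf := fun x y => by rw [f.map_inf, g.map_inf]
      map_sup := fun x y => by rw [f.map_sup, g.map_sup] }

namespace LGrpHom

variable {G H : Type u} [AddCommGroup G] [Lattice G] [AddCommGroup H] [Lattice H]
  (f : LGrpHom G H)

theorem map_zero : f.toFun 0 = 0 := by
  have h := f.map_add 0 0
  rw [add_zero] at h
  exact left_eq_add.1 h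

theorem map_sub (x y : G) : f.toFun (x - y) = f.toFun x - f.toFun y := by
  rw [eq_sub_iff_add_eq, ← f.map_add, sub_add_cancel]

theorem map_le {x y : G} (h : x ≤ y) : f.toFun x ≤ f.toFun y := by
  rw [← sup_eq_right, ← f.map_sup, sup_eq_right.2 h]

end LGrpHom

/-! ### The functor `Δ` -/

section Gamma

/-- The interval `[0, e]` of an abelian `ℓ`-group. -/
@[ext]
structure Gamma (G : Type u) [AddCommGroup G] [Lattice G] (e : G) : Type u where
  val : G
  mem_interval : 0 ≤ val ∧ val ≤ e

variable {G : Type u} [AddCommGroup G] [Lattice G] [IsOrderedAddMonoid G]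

theorem gamma_trunc (e a b c : G) (hc : 0 ≤ c) : ((a + b) ⊓ e + c) ⊓ e = (a + b + c) ⊓ e := by
  rw [inf_add, inf_assoc, inf_eq_right.2 (le_add_of_nonneg_right hc)]

theorem gamma_join (e x y : G) (hx : x ≤ e) (hy : y ≤ e) :
    (e - (e - x + y) ⊓ e + y) ⊓ e = x ⊔ y := by
  have h : e - (e - x + y) ⊓ e + y = x ⊔ y := by
    rw [sub_inf, sup_add]
    congr 1 <;> abel
  rw [h]
  exact inf_eq_left.2 (sup_le hx hy)

/-- The MV-algebra `Γ(G, e)`: the interval `[0, e]` with `x ⊕ y = (x + y) ∧ e` and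
`¬ x = e - x`. -/
@[reducible]
def gammaMV (e : G) (he : 0 ≤ e) : MVAlgebra (Gamma G e) where
  add x y := ⟨(x.1 + y.1) ⊓ e, le_inf (add_nonneg x.2.1 y.2.1) he, inf_le_right⟩
  zero := ⟨0, le_rfl, he⟩
  one := ⟨e, he, le_rfl⟩
  compl x := ⟨e - x.1, sub_nonneg.2 x.2.2, sub_le_self _ x.2.1⟩
  add_assoc x y z := Gamma.ext <| by
    change ((x.1 + y.1) ⊓ e + z.1) ⊓ e = (x.1 + (y.1 + z.1) ⊓ e) ⊓ e
    rw [gamma_trunc e _ _ _ z.2.1, add_comm x.1 ((y.1 + z.1) ⊓ e), gamma_trunc e _ _ _ x.2.1]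
    congr 1
    abel
  zero_add x := Gamma.ext <| by
    change (0 + x.1) ⊓ e = x.1
    rw [zero_add, inf_eq_left.2 x.2.2]
  add_zero x := Gamma.ext <| by
    change (x.1 + 0) ⊓ e = x.1
    rw [add_zero, inf_eq_left.2 x.2.2]
  add_comm x y := Gamma.ext <| by
    change (x.1 + y.1) ⊓ e = (y.1 + x.1) ⊓ e
    rw [add_comm]
  nsmul := @nsmulRec _ ⟨⟨0, le_rfl, he⟩⟩
    ⟨fun x y => ⟨(x.1 + y.1) ⊓ e, le_inf (add_nonneg x.2.1 y.2.1) he, inf_le_right⟩⟩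
  mv_compl_zero := Gamma.ext (sub_zero e)
  mv_add_one x := Gamma.ext <| by
    change (x.1 + e) ⊓ e = e
    exact inf_eq_right.2 (le_add_of_nonneg_left x.2.1)
  mv_compl_compl x := Gamma.ext (sub_sub_cancel e x.1)
  mv_lukasiewicz x y := Gamma.ext <| by
    change (e - (e - x.1 + y.1) ⊓ e + y.1) ⊓ e = (e - (e - y.1 + x.1) ⊓ e + x.1) ⊓ e
    rw [gamma_join e _ _ x.2.2 y.2.2, gamma_join e _ _ y.2.2 x.2.2, sup_comm]

end Gamma

section LexLattice

variable {G : Type u} [Lattice G]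

/-- The lattice structure of the lexicographic product of `ℤ` with a lattice; the order is
Mathlib's lexicographic order. -/
noncomputable instance lexIntLattice : Lattice (ℤ ×ₗ G) where
  toPartialOrder := Prod.Lex.instPartialOrder ℤ G
  sup x y := if (ofLex x).1 < (ofLex y).1 then y else if (ofLex y).1 < (ofLex x).1 then x
    else toLex ((ofLex x).1, (ofLex x).2 ⊔ (ofLex y).2)
  inf x y := if (ofLex x).1 < (ofLex y).1 then x else if (ofLex y).1 < (ofLex x).1 then y
    else toLex ((ofLex x).1, (ofLex x).2 ⊓ (ofLex y).2)
  le_sup_left x y := by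
    split_ifs with h1 h2
    · exact Prod.Lex.le_iff.2 (Or.inl h1)
    · exact le_rfl
    · exact Prod.Lex.le_iff.2 (Or.inr ⟨rfl, le_sup_left⟩)
  le_sup_right x y := by
    split_ifs with h1 h2
    · exact le_rfl
    · exact Prod.Lex.le_iff.2 (Or.inl h2)
    · exact Prod.Lex.le_iff.2 (Or.inr ⟨le_antisymm (not_lt.1 h1) (not_lt.1 h2), le_sup_right⟩)
  sup_le x y z hx hy := by
    split_ifs with h1 h2
    · exact hy
    · exact hx
    · rw [Prod.Lex.le_iff] at hx hy ⊢
      rcases hx with hx | hx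
      · exact Or.inl hx
      · rcases hy with hy | hy
        · exact Or.inl ((not_lt.1 h1).antisymm (not_lt.1 h2) ▸ hy)
        · exact Or.inr ⟨hx.1, sup_le hx.2 hy.2⟩
  inf_le_left x y := by
    split_ifs with h1 h2
    · exact le_rfl
    · exact Prod.Lex.le_iff.2 (Or.inl h2)
    · exact Prod.Lex.le_iff.2 (Or.inr ⟨rfl, inf_le_left⟩)
  inf_le_right x y := by
    split_ifs with h1 h2
    · exact Prod.Lex.le_iff.2 (Or.inl h1)
    · exact le_rfl
    · exact Prod.Lex.le_iff.2 (Or.inr ⟨le_antisymm (not_lt.1 h2) (not_lt.1 h1), inf_le_right⟩)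
  le_inf x y z hx hy := by
    split_ifs with h1 h2
    · exact hx
    · exact hy
    · rw [Prod.Lex.le_iff] at hx hy ⊢
      rcases hx with hx | hx
      · exact Or.inl hx
      · rcases hy with hy | hy
        · exact Or.inl (lt_of_lt_of_le hy (not_lt.1 h1))
        · exact Or.inr ⟨hx.1, le_inf hx.2 hy.2⟩

theorem lex_inf_def (x y : ℤ ×ₗ G) : x ⊓ y =
    if (ofLex x).1 < (ofLex y).1 then x else if (ofLex y).1 < (ofLex x).1 then y
    else toLex ((ofLex x).1, (ofLex x).2 ⊓ (ofLex y).2) := rfl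

theorem lex_sup_def (x y : ℤ ×ₗ G) : x ⊔ y =
    if (ofLex x).1 < (ofLex y).1 then y else if (ofLex y).1 < (ofLex x).1 then x
    else toLex ((ofLex x).1, (ofLex x).2 ⊔ (ofLex y).2) := rfl

end LexLattice

section Delta

/-- The unit `(1, 0)` of the lexicographic product of `ℤ` with `G`. -/
def lexUnit (G : Type u) [AddCommGroup G] : ℤ ×ₗ G := toLex (1, 0)

theorem lexUnit_nonneg (G : Type u) [AddCommGroup G] [Lattice G] : 0 ≤ lexUnit G :=
  Prod.Lex.le_iff.2 (Or.inl zero_lt_one)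

variable (G : Type u) [AddCommGroup G] [Lattice G] [IsOrderedAddMonoid G]

/-- The underlying set of `Δ(G) = Γ(ℤ ×ₗ G, (1, 0))`. -/
abbrev DeltaCarrier : Type u := Gamma (ℤ ×ₗ G) (lexUnit G)

noncomputable instance deltaMV : MVAlgebra (DeltaCarrier G) := gammaMV (lexUnit G) (lexUnit_nonneg G)


variable {G}

theorem delta_add_val (x y : DeltaCarrier G) : (x + y).1 = (x.1 + y.1) ⊓ lexUnit G := rfl

theorem delta_zero_val : (0 : DeltaCarrier G).1 = 0 := rfl

theorem delta_one_val : (1 : DeltaCarrier G).1 = lexUnit G := rfl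

theorem delta_compl_val (x : DeltaCarrier G) : xᶜ.1 = lexUnit G - x.1 := rfl

theorem delta_add_fst {x y : DeltaCarrier G} (hx : (ofLex x.1).1 = 0) (hy : (ofLex y.1).1 = 0) :
    (ofLex (x + y).1).1 = 0 := by
  have h : (ofLex (x.1 + y.1)).1 = 0 := by
    change (ofLex x.1).1 + (ofLex y.1).1 = 0
    rw [hx, hy, add_zero]
  have h2 : (ofLex (x.1 + y.1)).1 < (ofLex (lexUnit G)).1 := by
    rw [h]
    exact zero_lt_one
  rw [delta_add_val, lex_inf_def, if_pos h2, h]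

theorem delta_mem_rad {x : DeltaCarrier G} (hx : (ofLex x.1).1 = 0) :
    x ∈ rad (DeltaCarrier G) := by
  intro n _
  have hn : (ofLex (n • x).1).1 = 0 := by
    induction n with
    | zero =>
      rw [zero_smul]
      rfl
    | succ n ih =>
      rw [succ_nsmul]
      rcases Nat.eq_zero_or_pos n with rfl | h
      · rw [zero_smul, zero_add, hx]
      · exact delta_add_fst (ih h) hx
  rw [mv_le_iff]
  apply Gamma.ext
  rw [delta_add_val, delta_one_val, delta_compl_val, delta_compl_val]
  refine inf_eq_right.2 (Prod.Lex.le_iff.2 (Or.inl ?_))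
  change (1 : ℤ) < (1 - (ofLex (n • x).1).1) + (1 - (ofLex x.1).1)
  rw [hn, hx]
  norm_num

variable (G) in
theorem delta_isPerfect : IsPerfect (DeltaCarrier G) where
  zero_ne_one h := by
    have h2 : (0 : ℤ) = 1 := congrArg (fun x : DeltaCarrier G => (ofLex x.1).1) h
    exact zero_ne_one h2
  generated := by
    refine Set.eq_univ_of_forall fun x S hS => ?_
    have hx1 : 0 ≤ (ofLex x.1).1 := by
      rcases Prod.Lex.le_iff.1 x.2.1 with h | h
      · exact h.le
      · exact h.1.le
    have hx2 : (ofLex x.1).1 ≤ 1 := by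
      rcases Prod.Lex.le_iff.1 x.2.2 with h | h
      · exact h.le
      · exact h.1.le
    rcases hx1.eq_or_lt with h | h
    · exact hS.2 (delta_mem_rad h.symm)
    · have h1 : (ofLex x.1).1 = 1 := by omega
      have h2 : (ofLex xᶜ.1).1 = 0 := by
        change (1 : ℤ) - (ofLex x.1).1 = 0
        rw [h1, sub_self]
      have h3 := hS.1.compl_mem _ (hS.2 (delta_mem_rad h2))
      rwa [mv_compl_compl] at h3

variable {H : Type u} [AddCommGroup H] [Lattice H] [IsOrderedAddMonoid H]

/-- The homomorphism `(n, g) ↦ (n, f g)` of lexicographic products induced by `f`. -/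
def lexMap (f : LGrpHom G H) : LGrpHom (ℤ ×ₗ G) (ℤ ×ₗ H) where
  toFun x := toLex ((ofLex x).1, f.toFun (ofLex x).2)
  map_add x y := congrArg toLex (Prod.ext rfl (f.map_add _ _))
  map_inf x y := by
    rw [lex_inf_def]
    split_ifs with h1 h2
    · exact (if_pos h1).symm
    · exact ((if_neg h1).trans (if_pos h2)).symm
    · refine Eq.trans ?_ ((if_neg h1).trans (if_neg h2)).symm
      exact congrArg toLex (Prod.ext rfl (f.map_inf _ _))
  map_sup x y := by
    rw [lex_sup_def]
    split_ifs with h1 h2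
    · exact (if_pos h1).symm
    · exact ((if_neg h1).trans (if_pos h2)).symm
    · refine Eq.trans ?_ ((if_neg h1).trans (if_neg h2)).symm
      exact congrArg toLex (Prod.ext rfl (f.map_sup _ _))

theorem lexMap_unit {G H : Type u} [AddCommGroup G] [Lattice G] [AddCommGroup H] [Lattice H]
    (f : LGrpHom G H) : (lexMap f).toFun (lexUnit G) = lexUnit H :=
  congrArg toLex (Prod.ext rfl f.map_zero)

/-- The homomorphism `Δ(f) : Δ(G) → Δ(H)`, `(n, g) ↦ (n, f g)`. -/
def deltaMap (f : LGrpHom G H) : MVHom (DeltaCarrier G) (DeltaCarrier H) where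
  toFun x := ⟨(lexMap f).toFun x.1,
    by
      have h := (lexMap f).map_le x.2.1
      rwa [(lexMap f).map_zero] at h,
    by
      have h := (lexMap f).map_le x.2.2
      rwa [lexMap_unit] at h⟩
  map_zero := Gamma.ext (lexMap f).map_zero
  map_one := Gamma.ext (lexMap_unit f)
  map_add x y := Gamma.ext <| by
    change (lexMap f).toFun ((x.1 + y.1) ⊓ lexUnit G) =
      ((lexMap f).toFun x.1 + (lexMap f).toFun y.1) ⊓ lexUnit H
    rw [(lexMap f).map_inf, (lexMap f).map_add, lexMap_unit]
  map_compl x := Gamma.ext <| by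
    change (lexMap f).toFun (lexUnit G - x.1) = lexUnit H - (lexMap f).toFun x.1
    rw [(lexMap f).map_sub, lexMap_unit]

end Delta

/-- The functor `Δ` from abelian `ℓ`-groups to perfect MV-algebras,
`Δ(G) = Γ(ℤ ×ₗ G, (1, 0))`. -/
noncomputable def Delta : LGrp.{u} ⥤ PERF.{u} where
  obj G := ⟨⟨DeltaCarrier G.carrier⟩, delta_isPerfect G.carrier⟩
  map f := ObjectProperty.homMk (deltaMap f)

/-! ### The category `TOP` of positive cones of `ℓ`-groups with a top -/

/-- Lattices with a top element and with a commutative monoid structure, as objects of a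
category. -/
structure LatMonTop where
  carrier : Type u
  [addCommMonoid : AddCommMonoid carrier]
  [lattice : Lattice carrier]
  [orderTop : OrderTop carrier]

attribute [instance] LatMonTop.addCommMonoid LatMonTop.lattice LatMonTop.orderTop

/-- Homomorphisms for `+`, `0`, `∧`, `∨` that preserve the top and also preserve the part below
the top (in the case of positive cones with a top added: the positive cone). -/
@[ext]
structure LatMonTopHom (S T : Type u) [AddCommMonoid S] [Lattice S] [OrderTop S]
    [AddCommMonoid T] [Lattice T] [OrderTop T] where
  toFun : S → T
  map_zero : toFun 0 = 0
  map_add : ∀ x y, toFun (x + y) = toFun x + toFun y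
  map_inf : ∀ x y, toFun (x ⊓ y) = toFun x ⊓ toFun y
  map_sup : ∀ x y, toFun (x ⊔ y) = toFun x ⊔ toFun y
  map_top : toFun ⊤ = ⊤
  map_cone : ∀ x, x ≠ ⊤ → toFun x ≠ ⊤

instance : Category LatMonTop.{u} where
  Hom S T := LatMonTopHom S.carrier T.carrier
  id _ := ⟨fun x => x, rfl, fun _ _ => rfl, fun _ _ => rfl, fun _ _ => rfl, rfl, fun _ h => h⟩
  comp f g :=
    { toFun := fun x => g.toFun (f.toFun x)
      map_zero := by rw [f.map_zero, g.map_zero]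
      map_add := fun x y => by rw [f.map_add, g.map_add]
      map_inf := fun x y => by rw [f.map_inf, g.map_inf]
      map_sup := fun x y => by rw [f.map_sup, g.map_sup]
      map_top := by rw [f.map_top, g.map_top]
      map_cone := fun x hx => g.map_cone _ (f.map_cone x hx) }

/-- The positive cone of an `ℓ`-group is a sublattice. -/
@[reducible]
def coneLattice (G : LGrp.{u}) : Lattice {g : G.carrier // 0 ≤ g} :=
  Subtype.lattice (fun _ _ hx _ => le_sup_of_le_left hx) (fun _ _ hx hy => le_inf hx hy)

/-- The positive cone `{g | 0 ≤ g}` of an abelian `ℓ`-group with a new top element `⊤` added, where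
`x + ⊤ = ⊤`. -/
noncomputable def coneWithTop (G : LGrp.{u}) : LatMonTop.{u} where
  carrier := WithTop {g : G.carrier // 0 ≤ g}
  lattice := @WithTop.lattice _ (coneLattice G)
  orderTop := inferInstanceAs (OrderTop (WithTop {g : G.carrier // 0 ≤ g}))

/-- `S` is, up to isomorphism, the positive cone of an abelian `ℓ`-group with a top added. -/
def IsConeWithTop : ObjectProperty LatMonTop.{u} := fun S =>
  ∃ G : LGrp.{u}, Nonempty (S ≅ coneWithTop G)

/-- The category of positive cones of abelian `ℓ`-groups with a top. -/
abbrev TOP : Type (u + 1) := IsConeWithTop.{u}.FullSubcategory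

/-! ### The functor `θ` on perfect MV-algebras -/

/-- `θ(P)` for a perfect MV-algebra `P`, with the operations `⊕`, `∧`, `∨`, `0`, `1` of `P`. -/
def thetaObj (P : PERF.{u}) : LatMonTop.{u} where
  carrier := {x : P.obj.carrier // x ∈ theta P.obj.carrier}
  addCommMonoid :=
    { add := fun x y => ⟨x.1 + y.1, P.property.add_mem_theta x.2 y.2⟩
      zero := ⟨0, rad_subset_theta zero_mem_rad⟩
      add_assoc := fun _ _ _ => Subtype.ext (add_assoc _ _ _)
      zero_add := fun _ => Subtype.ext (zero_add _)
      add_zero := fun _ => Subtype.ext (add_zero _)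
      add_comm := fun _ _ => Subtype.ext (add_comm _ _)
      nsmul := @nsmulRec _ ⟨⟨0, rad_subset_theta zero_mem_rad⟩⟩
        ⟨fun x y => ⟨x.1 + y.1, P.property.add_mem_theta x.2 y.2⟩⟩ }
  lattice := Subtype.lattice (fun _ _ hx hy => P.property.sup_mem_theta hx hy)
    (fun _ _ hx hy => P.property.inf_mem_theta hx hy)
  orderTop :=
    { top := ⟨1, one_mem_theta⟩
      le_top := fun x => mv_le_one x.1 }

/-- `θ`, sending a perfect MV-algebra `P` to `θ(P)` and a homomorphism to its restriction. -/
def thetaFunctor : PERF.{u} ⥤ LatMonTop.{u} where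
  obj P := thetaObj P
  map {P Q} f :=
    { toFun := fun x => ⟨f.hom.toFun x.1, f.hom.map_theta x.2⟩
      map_zero := Subtype.ext f.hom.map_zero
      map_add := fun x y => Subtype.ext (f.hom.map_add x.1 y.1)
      map_inf := fun x y => Subtype.ext (f.hom.map_inf x.1 y.1)
      map_sup := fun x y => Subtype.ext (f.hom.map_sup x.1 y.1)
      map_top := Subtype.ext f.hom.map_one
      map_cone := fun x hx h => by
        rcases (P.property.mem_theta_iff x.1).1 x.2 with hr | h1
        · have h2 : f.hom.toFun x.1 = 1 := congrArg Subtype.val h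
          have h3 := f.hom.map_rad hr
          rw [h2] at h3
          exact Q.property.one_notMem_rad h3
        · exact hx (Subtype.ext h1) }

/-! The radical of a perfect MV-algebra `P` is a cancellative lattice-ordered monoid, canonically
ordered by `x ⊖ y = x ⊙ ¬y`, and `P` consists of the elements `x` and `¬x` with `x ∈ Rad(P)`.
For `x, y ∈ Rad(P)` one has `¬x ⊕ y = ¬(x ⊖ y)` and `¬x ⊕ ¬y = 1`, and `x ⊖ y` is determined by
`(x ⊖ y) ⊕ y = x ∨ y`. So `P` can be recovered from the monoid `Rad(P)`, and the homomorphisms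
`P → Q` are the maps `Rad(P) → Rad(Q)` that preserve `⊕`, `0` and `∨`. Since `θ(P)` is `Rad(P)` with
a top added, `θ` is full and faithful.

In the same way an abelian `ℓ`-group is determined by its positive cone, which is a cancellative,
canonically ordered lattice monoid; conversely the Grothendieck group of such a monoid is an
`ℓ`-group with the given positive cone. As `Rad(Δ(G))` is the positive cone of `G`, the functor `Δ`
is full and faithful, and `θ(Δ(G))` is the positive cone of `G` with a top added. -/

/-! ### Canonically ordered cancellative monoids -/

theorem canonicallyOrdered_sup_add {M : Type*} [AddCommMonoid M] [SemilatticeSup M]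
    [CanonicallyOrderedAdd M] [IsOrderedCancelAddMonoid M] (a b c : M) :
    a ⊔ b + c = (a + c) ⊔ (b + c) := by
  refine le_antisymm ?_ (sup_le (add_le_add_left le_sup_left c) (add_le_add_left le_sup_right c))
  obtain ⟨d, hd⟩ := exists_add_of_le (le_add_self.trans le_sup_left : c ≤ (a + c) ⊔ (b + c))
  rw [add_comm c] at hd
  have ha : a ≤ d := (add_le_add_iff_right c).1 (le_sup_left.trans_eq hd)
  have hb : b ≤ d := (add_le_add_iff_right c).1 (le_sup_right.trans_eq hd)
  exact (add_le_add_left (sup_le ha hb) c).trans_eq hd.symm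

/-- An additive isomorphism of canonically ordered monoids as an isomorphism of ordered monoids. -/
def canonicallyOrderedAddMonoidIso {M N : Type*} [Add M] [Preorder M] [CanonicallyOrderedAdd M]
    [Add N] [Preorder N] [CanonicallyOrderedAdd N] (e : M ≃+ N) : M ≃+o N where
  toAddEquiv := e
  map_le_map_iff' {x y} := by
    change e x ≤ e y ↔ x ≤ y
    rw [le_iff_exists_add, le_iff_exists_add, e.surjective.exists]
    simp only [← map_add, e.injective.eq_iff]

theorem canonicallyOrdered_map_sup {M N : Type*} [Add M] [SemilatticeSup M]
    [CanonicallyOrderedAdd M] [Add N] [SemilatticeSup N] [CanonicallyOrderedAdd N] (e : M ≃+ N)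
    (a b : M) : e (a ⊔ b) = e a ⊔ e b :=
  (canonicallyOrderedAddMonoidIso e : M ≃o N).map_sup a b

instance nonnegCanonicallyOrderedAdd {G : Type*} [AddCommGroup G] [PartialOrder G]
    [IsOrderedAddMonoid G] : CanonicallyOrderedAdd {g : G // 0 ≤ g} where
  exists_add_of_le {a b} h :=
    ⟨⟨b - a, sub_nonneg.2 h⟩, Subtype.ext (add_sub_cancel (a : G) (b : G)).symm⟩
  le_add_self a b := le_add_of_nonneg_left (a := (a : G)) b.2
  le_self_add a b := le_add_of_nonneg_right (a := (a : G)) b.2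

/-! ### The Grothendieck group of a lattice-ordered monoid -/

/-- The lattice structure of an ordered abelian group in which any two elements have a supremum;
infima are obtained by negation. -/
noncomputable abbrev latticeOfExistsIsLUB {G : Type*} [AddCommGroup G] [PartialOrder G]
    [IsOrderedAddMonoid G] (h : ∀ x y : G, ∃ z, IsLUB {x, y} z) : Lattice G :=
  Lattice.ofIsLUBofIsGLB (fun x y => (h x y).choose) (fun x y => -(h (-x) (-y)).choose)
    (fun x y => (h x y).choose_spec) fun x y => by
      simpa only [Set.neg_insert, Set.neg_singleton, neg_neg] using (h (-x) (-y)).choose_spec.neg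

section Grothendieck

open Algebra GrothendieckAddGroup

section Monoid

variable {M : Type*} [AddCommMonoid M]

theorem grothendieck_exists_of_sub_of (x : GrothendieckAddGroup M) :
    ∃ a c : M, x = of a - of c := by
  induction x using AddLocalization.ind with
  | _ y =>
    refine ⟨y.1, y.2, eq_sub_iff_add_eq.2 ?_⟩
    change AddLocalization.mk y.1 y.2 + AddLocalization.mk (y.2 : M) 0 = AddLocalization.mk y.1 0
    rw [AddLocalization.mk_add, add_zero, AddLocalization.mk_eq_mk_iff]
    exact AddLocalization.r_of_eq ((zero_add _).trans (add_comm _ _))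

theorem grothendieck_exists_common_of_sub_of (x y : GrothendieckAddGroup M) :
    ∃ a b c : M, x = of a - of c ∧ y = of b - of c := by
  obtain ⟨a, c, rfl⟩ := grothendieck_exists_of_sub_of x
  obtain ⟨b, d, rfl⟩ := grothendieck_exists_of_sub_of y
  refine ⟨a + d, b + c, c + d, ?_, ?_⟩ <;> simp only [map_add] <;> abel

end Monoid

section PartialOrder

variable {M : Type*} [AddCommMonoid M] [PartialOrder M] [IsOrderedCancelAddMonoid M]

theorem grothendieck_of_le_of {a b : M} : of a ≤ of b ↔ a ≤ b :=
  (AddLocalization.mkOrderEmbedding (0 : (⊤ : AddSubmonoid M))).le_iff_le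

theorem grothendieck_of_sub_of_le {a b c d : M} :
    of a - of c ≤ of b - of d ↔ a + d ≤ b + c := by
  rw [sub_le_sub_iff, ← map_add, ← map_add, grothendieck_of_le_of]

theorem grothendieck_of_nonneg [CanonicallyOrderedAdd M] (a : M) : 0 ≤ of a := by
  rw [← map_zero of, grothendieck_of_le_of]
  exact zero_le

theorem grothendieck_exists_of_eq_of_nonneg [CanonicallyOrderedAdd M] {x : GrothendieckAddGroup M}
    (hx : 0 ≤ x) : ∃ a, of a = x := by
  obtain ⟨a, c, rfl⟩ := grothendieck_exists_of_sub_of x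
  obtain ⟨d, rfl⟩ := exists_add_of_le (grothendieck_of_le_of.1 (sub_nonneg.1 hx))
  exact ⟨d, by rw [map_add, add_sub_cancel_left]⟩

variable (M) in
/-- A cancellative, canonically ordered monoid is the positive cone of its Grothendieck group. -/
noncomputable def grothendieckConeEquiv [CanonicallyOrderedAdd M] :
    M ≃+ {x : GrothendieckAddGroup M // 0 ≤ x} :=
  AddEquiv.ofBijective
    (AddHom.mk (fun a => ⟨of a, grothendieck_of_nonneg a⟩) fun a b => Subtype.ext (map_add of a b))
    ⟨fun _ _ h => of_injective (congrArg Subtype.val h), fun x =>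
      (grothendieck_exists_of_eq_of_nonneg x.2).imp fun _ => Subtype.ext⟩

end PartialOrder

variable {M : Type u} [AddCommMonoid M] [SemilatticeSup M] [CanonicallyOrderedAdd M]
  [IsOrderedCancelAddMonoid M]

theorem grothendieck_isLUB_pair (a b c : M) :
    IsLUB {of a - of c, of b - of c} (of (a ⊔ b) - of c) := by
  refine ⟨?_, fun z hz => ?_⟩
  · rintro _ (rfl | rfl) <;> rw [grothendieck_of_sub_of_le, add_le_add_iff_right]
    exacts [le_sup_left, le_sup_right]
  · obtain ⟨d, e, rfl⟩ := grothendieck_exists_of_sub_of z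
    have ha := hz (Set.mem_insert _ _)
    have hb := hz (Set.mem_insert_of_mem _ rfl)
    rw [grothendieck_of_sub_of_le] at ha hb ⊢
    rw [canonicallyOrdered_sup_add]
    exact sup_le ha hb

theorem grothendieck_exists_isLUB_pair (x y : GrothendieckAddGroup M) : ∃ z, IsLUB {x, y} z := by
  obtain ⟨a, b, c, rfl, rfl⟩ := grothendieck_exists_common_of_sub_of x y
  exact ⟨_, grothendieck_isLUB_pair a b c⟩

variable (M) in
/-- The Grothendieck group of a cancellative, canonically ordered join-semilattice monoid, as an
`ℓ`-group. -/
noncomputable def grothendieckLGrp : LGrp.{u} where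
  carrier := GrothendieckAddGroup M
  addCommGroup := inferInstance
  lattice := latticeOfExistsIsLUB grothendieck_exists_isLUB_pair
  isOrdered := inferInstanceAs (IsOrderedAddMonoid (GrothendieckAddGroup M))

end Grothendieck

/-! ### The radical as an ordered monoid -/

namespace MVAlgebra

section

variable (A : Type u) [MVAlgebra A]

/-- The radical as a submonoid of the monoid `(A, ⊕, 0)`. -/
def radSubmonoid : AddSubmonoid A where
  carrier := rad A
  zero_mem' := zero_mem_rad
  add_mem' := add_mem_rad

end

variable {A : Type u} [MVAlgebra A]

instance radLattice : Lattice (radSubmonoid A) :=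
  Subtype.lattice (fun _ _ hx hy => rad_of_le (add_mem_rad hx hy) (mv_sup_le_add _ _))
    (fun _ _ hx _ => rad_of_le hx inf_le_left)

/-- The truncated difference `x ⊖ y = x ⊙ ¬y` of elements of the radical. -/
instance radSub : Sub (radSubmonoid A) :=
  ⟨fun x y => ⟨odot x (y : A)ᶜ, rad_of_le x.2 (mv_odot_le_left _ _)⟩⟩

theorem rad_sub_add (x y : radSubmonoid A) : x - y + y = x ⊔ y :=
  Subtype.ext <| by
    change ((x : A)ᶜ + (y : A)ᶜᶜ)ᶜ + y = x ⊔ y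
    rw [mv_compl_compl]
    rfl

theorem rad_le_compl (x y : radSubmonoid A) : (x : A) ≤ (y : A)ᶜ :=
  mv_le_compl_of_square (by simpa only [one_nsmul] using x.2 1 one_pos)
    (by simpa only [one_nsmul] using y.2 1 one_pos)

theorem rad_compl_add (x y : radSubmonoid A) : (x : A)ᶜ + y = ((x - y : radSubmonoid A) : A)ᶜ := by
  change _ = ((x : A)ᶜ + (y : A)ᶜᶜ)ᶜᶜ
  rw [mv_compl_compl, mv_compl_compl]

theorem rad_compl_add_compl (x y : radSubmonoid A) : (x : A)ᶜ + (y : A)ᶜ = 1 :=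
  mv_le_iff.1 (rad_le_compl x y)

theorem rad_odot_compl_add (x y : radSubmonoid A) : odot (x : A)ᶜ (x + y : A) = y := by
  have h := mv_odot_compl_add (x : A)ᶜ y
  rwa [mv_compl_compl, inf_eq_right.2 (rad_le_compl y x)] at h

instance radIsOrderedCancelAddMonoid : IsOrderedCancelAddMonoid (radSubmonoid A) where
  add_le_add_left _ _ h c := mv_add_le_add h (le_refl (c : A))
  le_of_add_le_add_left a b c h := by
    have h' := mv_odot_mono (le_refl (a : A)ᶜ) (show (a + b : A) ≤ a + c from h)
    rwa [rad_odot_compl_add, rad_odot_compl_add] at h'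

instance radCanonicallyOrderedAdd : CanonicallyOrderedAdd (radSubmonoid A) where
  exists_add_of_le {a b} h := ⟨b - a, by rw [add_comm, rad_sub_add, sup_eq_left.2 h]⟩
  le_add_self a b := mv_le_add_left (a : A) b
  le_self_add a b := mv_le_add_right (a : A) b

theorem IsPerfect.compl_notMem_rad (hA : IsPerfect A) (x : radSubmonoid A) :
    (x : A)ᶜ ∉ rad A := fun h => by
  have h' := add_mem_rad h x.2
  rw [mv_compl_add_self] at h'
  exact hA.one_notMem_rad h'

theorem IsPerfect.ne_one (hA : IsPerfect A) (x : radSubmonoid A) : (x : A) ≠ 1 := fun h =>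
  hA.one_notMem_rad (h ▸ x.2)

theorem IsPerfect.rad_induction (hA : IsPerfect A) {motive : A → Prop}
    (coe : ∀ a : radSubmonoid A, motive a) (compl : ∀ a : radSubmonoid A, motive (a : A)ᶜ)
    (x : A) : motive x := by
  rcases hA.mem_or x with hx | hx
  · exact coe ⟨x, hx⟩
  · exact mv_compl_compl x ▸ compl ⟨xᶜ, hx⟩

end MVAlgebra

/-! ### Homomorphisms of perfect MV-algebras -/

section MVHom

variable {A B : Type u} [MVAlgebra A] [MVAlgebra B]

/-- The restriction of a homomorphism of MV-algebras to the radicals. -/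
def MVHom.radMap (f : MVHom A B) : radSubmonoid A →+ radSubmonoid B where
  toFun x := ⟨f.toFun x, f.map_rad x.2⟩
  map_zero' := Subtype.ext f.map_zero
  map_add' x y := Subtype.ext (f.map_add x y)

theorem MVHom.radMap_sup (f : MVHom A B) (x y : radSubmonoid A) :
    f.radMap (x ⊔ y) = f.radMap x ⊔ f.radMap y :=
  Subtype.ext (f.map_sup x y)

theorem MVHom.ext_of_radMap (hA : IsPerfect A) {f g : MVHom A B} (h : f.radMap = g.radMap) :
    f = g := by
  have hrad (a : radSubmonoid A) : f.toFun a = g.toFun a :=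
    congrArg Subtype.val (DFunLike.congr_fun h a)
  refine MVHom.ext (funext (hA.rad_induction hrad fun a => ?_))
  rw [f.map_compl, g.map_compl, hrad]

open Classical in
/-- The extension of a map `p` of radicals to a perfect MV-algebra by `¬a ↦ ¬(p a)`. -/
noncomputable def radExtend (hA : IsPerfect A) (p : radSubmonoid A → radSubmonoid B) (x : A) : B :=
  if hx : x ∈ rad A then p ⟨x, hx⟩ else (p ⟨xᶜ, (hA.mem_or x).resolve_left hx⟩ : B)ᶜ

section RadExtend

variable (hA : IsPerfect A)

theorem radExtend_coe (p : radSubmonoid A → radSubmonoid B) (a : radSubmonoid A) :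
    radExtend hA p a = p a :=
  dif_pos a.2

theorem radExtend_coe_compl (p : radSubmonoid A → radSubmonoid B) (a : radSubmonoid A) :
    radExtend hA p (a : A)ᶜ = (p a : B)ᶜ := by
  simp only [radExtend, dif_neg (hA.compl_notMem_rad a), mv_compl_compl]

theorem radExtend_compl (p : radSubmonoid A → radSubmonoid B) (x : A) :
    radExtend hA p xᶜ = (radExtend hA p x)ᶜ := by
  induction x using hA.rad_induction with
  | coe a => rw [radExtend_coe_compl, radExtend_coe]
  | compl a => rw [mv_compl_compl, radExtend_coe_compl, radExtend_coe, mv_compl_compl]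

theorem rad_map_sub (p : radSubmonoid A →+ radSubmonoid B) (hp : ∀ a b, p (a ⊔ b) = p a ⊔ p b)
    (a b : radSubmonoid A) : p (a - b) = p a - p b := by
  have h : p (a - b) + p b = p a - p b + p b := by rw [← map_add, rad_sub_add, rad_sub_add, hp]
  exact add_right_cancel h

theorem radExtend_compl_add (p : radSubmonoid A →+ radSubmonoid B)
    (hp : ∀ a b, p (a ⊔ b) = p a ⊔ p b) (a b : radSubmonoid A) :
    radExtend hA p ((a : A)ᶜ + b) = (p a : B)ᶜ + p b := by
  rw [rad_compl_add, radExtend_coe_compl, rad_map_sub p hp, rad_compl_add]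

theorem radExtend_zero (p : radSubmonoid A →+ radSubmonoid B) : radExtend hA p 0 = 0 :=
  (radExtend_coe hA p 0).trans (congrArg Subtype.val (map_zero p))

theorem radExtend_one (p : radSubmonoid A →+ radSubmonoid B) : radExtend hA p 1 = 1 := by
  rw [← mv_compl_zero, radExtend_compl, radExtend_zero, mv_compl_zero]

theorem radExtend_add (p : radSubmonoid A →+ radSubmonoid B) (hp : ∀ a b, p (a ⊔ b) = p a ⊔ p b)
    (x y : A) : radExtend hA p (x + y) = radExtend hA p x + radExtend hA p y := by
  induction x using hA.rad_induction with
  | coe a =>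
    induction y using hA.rad_induction with
    | coe b =>
      rw [← AddSubmonoid.coe_add, radExtend_coe, radExtend_coe, radExtend_coe, map_add,
        AddSubmonoid.coe_add]
    | compl b =>
      rw [add_comm, radExtend_compl_add hA p hp, radExtend_coe, radExtend_coe_compl, add_comm]
  | compl a =>
    induction y using hA.rad_induction with
    | coe b => rw [radExtend_compl_add hA p hp, radExtend_coe, radExtend_coe_compl]
    | compl b =>
      rw [rad_compl_add_compl, radExtend_one, radExtend_coe_compl, radExtend_coe_compl,
        rad_compl_add_compl]

/-- A map of radicals that preserves `⊕`, `0` and `∨` as a homomorphism of MV-algebras. -/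
noncomputable def MVHom.ofRad (p : radSubmonoid A →+ radSubmonoid B)
    (hp : ∀ a b, p (a ⊔ b) = p a ⊔ p b) : MVHom A B where
  toFun := radExtend hA p
  map_zero := radExtend_zero hA p
  map_one := radExtend_one hA p
  map_add := radExtend_add hA p hp
  map_compl := radExtend_compl hA p

end RadExtend

end MVHom

/-! ### `θ(P)` is the radical with a top added -/

section Theta

variable {P Q : PERF.{u}}

/-- The inclusion of the radical of `P` in `θ(P)`. -/
def radToTheta (x : radSubmonoid P.obj.carrier) : (thetaObj P).carrier :=
  ⟨x, rad_subset_theta x.2⟩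

theorem radToTheta_injective : Function.Injective (radToTheta (P := P)) := fun _ _ h =>
  Subtype.ext (congrArg (fun z : (thetaObj P).carrier => z.1) h)

theorem radToTheta_ne_top (x : radSubmonoid P.obj.carrier) : radToTheta x ≠ ⊤ := fun h =>
  P.property.ne_one x (congrArg (fun z : (thetaObj P).carrier => z.1) h)

theorem eq_top_or_exists_radToTheta_eq (x : (thetaObj P).carrier) :
    x = ⊤ ∨ ∃ a, radToTheta a = x :=
  ((P.property.mem_theta_iff x.1).1 x.2).elim (fun hx => Or.inr ⟨⟨x.1, hx⟩, rfl⟩)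
    fun hx => Or.inl (Subtype.ext hx)

theorem theta_add_top (x : (thetaObj P).carrier) : x + ⊤ = ⊤ := Subtype.ext (mv_add_one x.1)

theorem theta_top_add (x : (thetaObj P).carrier) : ⊤ + x = ⊤ := by rw [add_comm, theta_add_top]

instance thetaCanonicallyOrderedAdd : CanonicallyOrderedAdd (thetaObj P).carrier where
  exists_add_of_le {a b} h := by
    obtain rfl | ⟨b, rfl⟩ := eq_top_or_exists_radToTheta_eq b
    · exact ⟨⊤, (theta_add_top a).symm⟩
    · obtain ⟨a, rfl⟩ : ∃ a', radToTheta a' = a := ⟨⟨a.1, rad_of_le b.2 h⟩, rfl⟩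
      obtain ⟨c, rfl⟩ := exists_add_of_le (show a ≤ b from h)
      exact ⟨radToTheta c, rfl⟩
  le_add_self a b := mv_le_add_left a.1 b.1
  le_self_add a b := mv_le_add_right a.1 b.1

/-- The extension of the inclusion of the radical in `θ(P)` by `⊤ ↦ ⊤`. -/
def radWithTopToTheta : WithTop (radSubmonoid P.obj.carrier) → (thetaObj P).carrier :=
  WithTop.recTopCoe ⊤ radToTheta

theorem radWithTopToTheta_bijective : Function.Bijective (radWithTopToTheta (P := P)) := by
  constructor
  · intro x y h
    cases x <;> cases y
    · rfl
    · exact absurd h.symm (radToTheta_ne_top _)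
    · exact absurd h (radToTheta_ne_top _)
    · exact congrArg _ (radToTheta_injective h)
  · intro x
    obtain rfl | ⟨a, rfl⟩ := eq_top_or_exists_radToTheta_eq x
    exacts [⟨⊤, rfl⟩, ⟨a, rfl⟩]

theorem radWithTopToTheta_add (x y : WithTop (radSubmonoid P.obj.carrier)) :
    radWithTopToTheta (x + y) = radWithTopToTheta x + radWithTopToTheta y := by
  cases x with
  | top => exact (theta_top_add _).symm
  | coe a =>
    cases y with
    | top => exact (theta_add_top _).symm
    | coe b => rfl

variable (P) in
/-- `θ(P)` is the monoid `Rad(P)` with a top added. -/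
noncomputable def radWithTopEquivTheta :
    WithTop (radSubmonoid P.obj.carrier) ≃+ (thetaObj P).carrier :=
  AddEquiv.ofBijective (AddHom.mk radWithTopToTheta radWithTopToTheta_add)
    radWithTopToTheta_bijective

/-! ### `θ` is full and faithful -/

/-- The map of radicals `Rad(P) → Rad(Q)` induced by a morphism `θ(P) → θ(Q)`. -/
def thetaRadMap (φ : LatMonTopHom (thetaObj P).carrier (thetaObj Q).carrier) :
    radSubmonoid P.obj.carrier →+ radSubmonoid Q.obj.carrier where
  toFun x := ⟨(φ.toFun (radToTheta x)).1,
    ((Q.property.mem_theta_iff _).1 (φ.toFun (radToTheta x)).2).resolve_right fun h =>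
      φ.map_cone _ (radToTheta_ne_top x) (Subtype.ext h)⟩
  map_zero' := radToTheta_injective φ.map_zero
  map_add' x y := radToTheta_injective (φ.map_add (radToTheta x) (radToTheta y))

theorem radToTheta_thetaRadMap (φ : LatMonTopHom (thetaObj P).carrier (thetaObj Q).carrier)
    (x : radSubmonoid P.obj.carrier) :
    radToTheta (thetaRadMap φ x) = φ.toFun (radToTheta x) :=
  rfl

theorem thetaRadMap_sup (φ : LatMonTopHom (thetaObj P).carrier (thetaObj Q).carrier)
    (x y : radSubmonoid P.obj.carrier) :
    thetaRadMap φ (x ⊔ y) = thetaRadMap φ x ⊔ thetaRadMap φ y :=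
  radToTheta_injective (φ.map_sup (radToTheta x) (radToTheta y))

theorem thetaRadMap_injective : Function.Injective (thetaRadMap (P := P) (Q := Q)) :=
  fun φ ψ h => LatMonTopHom.ext <| funext fun x => by
    obtain rfl | ⟨a, rfl⟩ := eq_top_or_exists_radToTheta_eq x
    · rw [φ.map_top, ψ.map_top]
    · rw [← radToTheta_thetaRadMap, h, radToTheta_thetaRadMap]

instance thetaFunctor_faithful : thetaFunctor.{u}.Faithful where
  map_injective {P _ _ _} h :=
    ObjectProperty.hom_ext _ (MVHom.ext_of_radMap P.property (congrArg thetaRadMap h))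

instance thetaFunctor_full : thetaFunctor.{u}.Full where
  map_surjective {P Q} φ := by
    refine ⟨ObjectProperty.homMk (MVHom.ofRad P.property (thetaRadMap φ) (thetaRadMap_sup φ)),
      thetaRadMap_injective (DFunLike.ext _ _ fun x => Subtype.ext ?_)⟩
    exact radExtend_coe P.property (thetaRadMap φ) x

end Theta

/-! ### `θ(P)` is a positive cone with a top added -/

/-- An isomorphism of canonically ordered monoids preserves the order, hence the lattice operations
and the top. -/
def LatMonTopHom.ofAddEquiv {S T : Type u} [AddCommMonoid S] [Lattice S] [OrderTop S]
    [CanonicallyOrderedAdd S] [AddCommMonoid T] [Lattice T] [OrderTop T] [CanonicallyOrderedAdd T]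
    (e : S ≃+ T) : LatMonTopHom S T where
  toFun := e
  map_zero := e.map_zero
  map_add := e.map_add
  map_inf := (canonicallyOrderedAddMonoidIso e : S ≃o T).map_inf
  map_sup := canonicallyOrdered_map_sup e
  map_top := (canonicallyOrderedAddMonoidIso e : S ≃o T).map_top
  map_cone _ hx h :=
    hx (e.injective (h.trans (canonicallyOrderedAddMonoidIso e : S ≃o T).map_top.symm))

/-- The isomorphism in `LatMonTop` given by an isomorphism of canonically ordered monoids. -/
def LatMonTop.isoOfAddEquiv {S T : LatMonTop.{u}} [CanonicallyOrderedAdd S.carrier]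
    [CanonicallyOrderedAdd T.carrier] (e : S.carrier ≃+ T.carrier) : S ≅ T where
  hom := LatMonTopHom.ofAddEquiv e
  inv := LatMonTopHom.ofAddEquiv e.symm
  hom_inv_id := LatMonTopHom.ext (funext e.symm_apply_apply)
  inv_hom_id := LatMonTopHom.ext (funext e.apply_symm_apply)

instance coneWithTopCanonicallyOrderedAdd (G : LGrp.{u}) :
    CanonicallyOrderedAdd (coneWithTop G).carrier :=
  inferInstanceAs (CanonicallyOrderedAdd (WithTop {g : G.carrier // 0 ≤ g}))

/-- If the radical of `P` is the positive cone of `G`, then `θ(P)` is that cone with a top added. -/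
noncomputable def thetaIsoConeWithTop {P : PERF.{u}} {G : LGrp.{u}}
    (e : radSubmonoid P.obj.carrier ≃+ {g : G.carrier // 0 ≤ g}) :
    thetaFunctor.obj P ≅ coneWithTop G :=
  LatMonTop.isoOfAddEquiv (S := thetaObj P) (T := coneWithTop G)
    ((radWithTopEquivTheta P).symm.trans e.withTopCongr)

theorem isConeWithTop_theta (P : PERF.{u}) : IsConeWithTop.{u} (thetaFunctor.{u}.obj P) :=
  ⟨grothendieckLGrp (radSubmonoid P.obj.carrier),
    ⟨thetaIsoConeWithTop (grothendieckConeEquiv (radSubmonoid P.obj.carrier))⟩⟩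

/-! ### The radical of `Δ(G)` -/

section DeltaRad

variable {G : Type u} [AddCommGroup G] [Lattice G]

theorem delta_fst_nonneg (x : DeltaCarrier G) : 0 ≤ (ofLex x.1).1 :=
  (Prod.Lex.le_iff.1 x.2.1).elim le_of_lt fun h => h.1.le

theorem delta_fst_le_one (x : DeltaCarrier G) : (ofLex x.1).1 ≤ 1 :=
  (Prod.Lex.le_iff.1 x.2.2).elim le_of_lt fun h => h.1.le

/-- The element `(0, g)` of `Δ(G)`, for `g ≥ 0`. -/
def deltaOf (g : {g : G // 0 ≤ g}) : DeltaCarrier G :=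
  ⟨toLex (0, g), Prod.Lex.le_iff.2 (Or.inr ⟨rfl, g.2⟩), Prod.Lex.le_iff.2 (Or.inl zero_lt_one)⟩

variable [IsOrderedAddMonoid G]

theorem delta_mem_rad_iff {x : DeltaCarrier G} :
    x ∈ rad (DeltaCarrier G) ↔ (ofLex x.1).1 = 0 := by
  refine ⟨fun hx => ?_, delta_mem_rad⟩
  by_contra hne
  have hcompl : xᶜ ∈ rad (DeltaCarrier G) := delta_mem_rad <| by
    have h0 := delta_fst_nonneg x
    have h1 := delta_fst_le_one x
    change (1 : ℤ) - (ofLex x.1).1 = 0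
    omega
  exact (delta_isPerfect G).compl_notMem_rad ⟨x, hx⟩ hcompl

theorem delta_snd_nonneg {x : DeltaCarrier G} (hx : x ∈ rad (DeltaCarrier G)) :
    0 ≤ (ofLex x.1).2 :=
  (Prod.Lex.le_iff.1 x.2.1).elim (fun h => absurd (delta_mem_rad_iff.1 hx) h.ne') And.right

theorem deltaOf_add (g h : {g : G // 0 ≤ g}) : deltaOf (g + h) = deltaOf g + deltaOf h := by
  refine Gamma.ext ?_
  rw [delta_add_val, inf_eq_left.2]
  · exact congrArg toLex (Prod.ext (add_zero (0 : ℤ)).symm rfl)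
  · exact Prod.Lex.le_iff.2 (Or.inl (show (0 : ℤ) + 0 < 1 by norm_num))

variable (G) in
/-- The radical of `Δ(G)` is the positive cone of `G`. -/
noncomputable def deltaRadEquiv : radSubmonoid (DeltaCarrier G) ≃+ {g : G // 0 ≤ g} :=
  AddEquiv.symm
    { toFun := fun g => ⟨deltaOf g, delta_mem_rad rfl⟩
      invFun := fun x => ⟨(ofLex x.1.1).2, delta_snd_nonneg x.2⟩
      left_inv := fun _ => rfl
      right_inv := fun x => Subtype.ext <|
        Gamma.ext (congrArg toLex (Prod.ext (delta_mem_rad_iff.1 x.2).symm rfl))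
      map_add' := fun g h => Subtype.ext (deltaOf_add g h) }

end DeltaRad

/-! ### Homomorphisms of `ℓ`-groups -/

section Nonneg

theorem exists_nonneg_sub_nonneg {G : Type*} [AddCommGroup G] [Lattice G] [IsOrderedAddMonoid G]
    (x : G) : ∃ a b : {g : G // 0 ≤ g}, x = a - b :=
  ⟨⟨x⁺, posPart_nonneg x⟩, ⟨x⁻, negPart_nonneg x⟩, (posPart_sub_negPart x).symm⟩

theorem exists_nonneg_common_sub {G : Type*} [AddCommGroup G] [Lattice G] [IsOrderedAddMonoid G]
    (x y : G) : ∃ a b c : {g : G // 0 ≤ g}, x = a - c ∧ y = b - c := by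
  obtain ⟨a, c, rfl⟩ := exists_nonneg_sub_nonneg x
  obtain ⟨b, d, rfl⟩ := exists_nonneg_sub_nonneg y
  refine ⟨a + d, b + c, c + d, ?_, ?_⟩ <;> simp only [Nonneg.coe_add] <;> abel

theorem LGrpHom.ext_of_nonneg {G H : Type u} [AddCommGroup G] [Lattice G] [IsOrderedAddMonoid G]
    [AddCommGroup H] [Lattice H] {f g : LGrpHom G H}
    (h : ∀ a : {g : G // 0 ≤ g}, f.toFun a = g.toFun a) : f = g :=
  LGrpHom.ext <| funext fun x => by
    obtain ⟨a, b, rfl⟩ := exists_nonneg_sub_nonneg x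
    rw [f.map_sub, g.map_sub, h, h]

variable {G H : Type u} [AddCommGroup G] [Lattice G] [IsOrderedAddMonoid G] [AddCommGroup H]
  (p : {g : G // 0 ≤ g} →+ H)

/-- The additive extension of a map of the positive cone to the whole `ℓ`-group. -/
def nonnegExtend (x : G) : H :=
  p ⟨x⁺, posPart_nonneg x⟩ - p ⟨x⁻, negPart_nonneg x⟩

theorem nonnegExtend_sub (a b : {g : G // 0 ≤ g}) : nonnegExtend p (a - b) = p a - p b := by
  rw [nonnegExtend, sub_eq_sub_iff_add_eq_add, ← map_add, ← map_add]
  exact congrArg p (Subtype.ext (sub_eq_sub_iff_add_eq_add.1 (posPart_sub_negPart (a - b : G))))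

theorem nonnegExtend_coe (a : {g : G // 0 ≤ g}) : nonnegExtend p a = p a := by
  simpa only [Nonneg.coe_zero, sub_zero, map_zero] using nonnegExtend_sub p a 0

theorem nonnegExtend_add (x y : G) :
    nonnegExtend p (x + y) = nonnegExtend p x + nonnegExtend p y := by
  obtain ⟨a, b, rfl⟩ := exists_nonneg_sub_nonneg x
  obtain ⟨c, d, rfl⟩ := exists_nonneg_sub_nonneg y
  rw [sub_add_sub_comm, ← Nonneg.coe_add, ← Nonneg.coe_add]
  simp only [nonnegExtend_sub, map_add, sub_add_sub_comm]

variable [Lattice H] [IsOrderedAddMonoid H]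

theorem nonnegExtend_sup (hp : ∀ a b, p (a ⊔ b) = p a ⊔ p b) (x y : G) :
    nonnegExtend p (x ⊔ y) = nonnegExtend p x ⊔ nonnegExtend p y := by
  obtain ⟨a, b, c, rfl, rfl⟩ := exists_nonneg_common_sub x y
  rw [← sup_sub, nonnegExtend_sub, nonnegExtend_sub, ← sup_sub, ← hp]
  exact nonnegExtend_sub p (a ⊔ b) c

theorem nonnegExtend_inf (hp : ∀ a b, p (a ⊔ b) = p a ⊔ p b) (x y : G) :
    nonnegExtend p (x ⊓ y) = nonnegExtend p x ⊓ nonnegExtend p y := by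
  refine add_right_cancel (b := nonnegExtend p (x ⊔ y)) ?_
  rw [← nonnegExtend_add, inf_add_sup, nonnegExtend_add, nonnegExtend_sup p hp, inf_add_sup]

/-- A map of the positive cone that preserves `+`, `0` and `∨`, as a homomorphism of
`ℓ`-groups. -/
def LGrpHom.ofNonneg (hp : ∀ a b, p (a ⊔ b) = p a ⊔ p b) : LGrpHom G H where
  toFun := nonnegExtend p
  map_add := nonnegExtend_add p
  map_inf := nonnegExtend_inf p hp
  map_sup := nonnegExtend_sup p hp

end Nonneg

/-! ### `Δ` is full and faithful -/

section DeltaHom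

variable {G H : Type u} [AddCommGroup G] [Lattice G] [IsOrderedAddMonoid G] [AddCommGroup H]
  [Lattice H] [IsOrderedAddMonoid H]

/-- The map of positive cones `G⁺ → H⁺`, with values in `H`, induced by a homomorphism
`Δ(G) → Δ(H)`. -/
noncomputable def deltaNonnegMap (ψ : MVHom (DeltaCarrier G) (DeltaCarrier H)) :
    {g : G // 0 ≤ g} →+ H :=
  Nonneg.coeAddMonoidHom.comp <| (deltaRadEquiv H).toAddMonoidHom.comp <|
    ψ.radMap.comp (deltaRadEquiv G).symm.toAddMonoidHom

theorem deltaNonnegMap_sup (ψ : MVHom (DeltaCarrier G) (DeltaCarrier H)) (a b : {g : G // 0 ≤ g}) :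
    deltaNonnegMap ψ (a ⊔ b) = deltaNonnegMap ψ a ⊔ deltaNonnegMap ψ b := by
  change (deltaRadEquiv H (ψ.radMap ((deltaRadEquiv G).symm (a ⊔ b))) : H) = _
  rw [canonicallyOrdered_map_sup, ψ.radMap_sup, canonicallyOrdered_map_sup]
  rfl

theorem deltaNonnegMap_deltaMap (f : LGrpHom G H) (a : {g : G // 0 ≤ g}) :
    deltaNonnegMap (deltaMap f) a = f.toFun a :=
  rfl

theorem deltaNonnegMap_injective : Function.Injective (deltaNonnegMap (G := G) (H := H)) :=
  fun φ ψ h => MVHom.ext_of_radMap (delta_isPerfect G) <| DFunLike.ext _ _ fun x =>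
    (deltaRadEquiv H).injective <| Subtype.ext <| by
      simpa [deltaNonnegMap] using DFunLike.congr_fun h (deltaRadEquiv G x)

end DeltaHom

instance Delta_faithful : Delta.{u}.Faithful where
  map_injective {_ _ f g} h := LGrpHom.ext_of_nonneg fun a => by
    have h' : deltaMap f = deltaMap g := congrArg (fun k => k.hom) h
    rw [← deltaNonnegMap_deltaMap, h', deltaNonnegMap_deltaMap]

instance Delta_full : Delta.{u}.Full where
  map_surjective ψ := by
    let f := LGrpHom.ofNonneg (deltaNonnegMap ψ.hom) (deltaNonnegMap_sup ψ.hom)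
    refine ⟨f, ObjectProperty.hom_ext _ (deltaNonnegMap_injective (DFunLike.ext _ _ fun a => ?_))⟩
    exact nonnegExtend_coe (deltaNonnegMap ψ.hom) a

theorem delta_comp_theta_essSurj :
    (Delta.{u} ⋙ IsConeWithTop.{u}.lift thetaFunctor.{u} isConeWithTop_theta).EssSurj where
  mem_essImage S := by
    obtain ⟨G, ⟨i⟩⟩ := S.property
    exact ⟨G, ⟨ObjectProperty.isoMk _
      (thetaIsoConeWithTop (P := Delta.obj G) (deltaRadEquiv G.carrier) ≪≫ i.symm)⟩⟩

theorem mainTheorem2 :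
    (∀ P : PERF.{u}, theta P.obj.carrier = rad P.obj.carrier ∪ {1}) ∧
    ∃ h : ∀ P : PERF.{u}, IsConeWithTop.{u} (thetaFunctor.{u}.obj P),
      (IsConeWithTop.{u}.lift thetaFunctor.{u} h : PERF.{u} ⥤ TOP.{u}).IsEquivalence ∧
      (Delta.{u} ⋙ IsConeWithTop.{u}.lift thetaFunctor.{u} h : LGrp.{u} ⥤ TOP.{u}).IsEquivalence := by
  refine ⟨fun P => Set.ext P.property.mem_theta_iff, isConeWithTop_theta, ?_⟩
  have hΔθ := delta_comp_theta_essSurj.{u}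
  have hθ : (IsConeWithTop.{u}.lift thetaFunctor.{u} isConeWithTop_theta).EssSurj :=
    ⟨fun S => let ⟨G, hG⟩ := hΔθ.mem_essImage S; ⟨Delta.obj G, hG⟩⟩
  exact ⟨{}, {}⟩
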